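/- Let $\mathbb{K}$ be a field of characteristic zero, $l\ge 0$, and $S=\mathbb{K}[x_1,\dots,x_l]$. Let $\mathcal{A}$ be a central hyperplane arrangement in $\mathbb{K}^l$, i.e. a finite set of linear hyperplanes, and for each $H\in\mathcal{A}$ fix a linear form $\alpha_H\in S$ with $H=\alpha_H^{-1}(0)$. Put $Q(\mathcal{A})=\prod_{H\in\mathcal{A}}\alpha_H$, let $J(\mathcal{A})\subseteq S$ be the ideal generated by $Q(\mathcal{A})$ and all its partial derivatives, and let $D(\mathcal{A})$ be the $S$-module of all polynomial vector fields $\delta=\sum_{i=1}^l f_i\partial_{x_i}$ ($f_i\in S$) with $\delta(\alpha_H)\in\langle\alpha_H\rangle$ for all $H\in\mathcal{A}$. The arrangement $\mathcal{A}$ is called free if $D(\mathcal{A})$ has an $S$-basis $\delta_1,\dots,\delta_l$ such that, for each $i$, the coefficients of $\delta_i$ are homogeneous polynomials of one common degree $e_i$. A flat of $\mathcal{A}$ is an intersection of a (possibly empty) subset of $\mathcal{A}$, and the localization of $\mathcal{A}$ at a flat $X$ is $\mathcal{A}_X=\{H\in\mathcal{A}\mid X\subseteq H\}$. Write $\operatorname{pd}$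 for the projective dimension of an $S$-module (with $\operatorname{pd}(0)=-\infty$). Then for every flat $X$ of $\mathcal{A}$, $$\operatorname{pd}(S/J(\mathcal{A}_X))\le\operatorname{pd}(S/J(\mathcal{A}))\quad\text{and (equivalently)}\quad \operatorname{pd}(D(\mathcal{A}_X))\le\operatorname{pd}(D(\mathcal{A})).$$ As a consequence, if $\mathcal{A}$ is free, then $\mathcal{A}_X$ is free. -/

import Mathlib

open MvPolynomial

/-- A central hyperplane arrangement in `K^l`: a finite set of linear hyperplanes (subspaces of
codimension one, i.e. maximal proper subspaces), together with a fixed linear form `form H`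
defining each hyperplane `H` of the arrangement.  The values of `form` on subspaces which do not
belong to the arrangement play no role. -/
structure CentralArrangement (K : Type*) [Field K] (l : ℕ) where
  /-- the hyperplanes of the arrangement -/
  hyperplanes : Finset (Submodule K (Fin l → K))
  isCoatom_of_mem : ∀ H ∈ hyperplanes, IsCoatom H
  /-- the chosen defining polynomials -/
  form : Submodule K (Fin l → K) → MvPolynomial (Fin l) K
  form_isHomogeneous : ∀ H ∈ hyperplanes, (form H).IsHomogeneous 1
  mem_iff_eval_form : ∀ H ∈ hyperplanes, ∀ v : Fin l → K, v ∈ H ↔ eval v (form H) = 0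

namespace CentralArrangement

variable {K : Type*} [Field K] {l : ℕ}

/-- The lattice of intersections `L(A)`: all intersections of subsets of `A`
(the empty intersection is the whole space). -/
def flats (A : CentralArrangement K l) : Set (Submodule K (Fin l → K)) :=
  {X | ∃ B ⊆ A.hyperplanes, X = B.inf id}

open Classical in
/-- The localization `A_X = {H ∈ A | X ⊆ H}`, with the defining forms inherited from `A`. -/
noncomputable def localization (A : CentralArrangement K l) (X : Submodule K (Fin l → K)) :
    CentralArrangement K l where
  hyperplanes := A.hyperplanes.filter (fun H => X ≤ H)
  isCoatom_of_mem H hH := A.isCoatom_of_mem H (Finset.mem_filter.mp hH).1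
  form := A.form
  form_isHomogeneous H hH := A.form_isHomogeneous H (Finset.mem_filter.mp hH).1
  mem_iff_eval_form H hH := A.mem_iff_eval_form H (Finset.mem_filter.mp hH).1

/-- The defining polynomial `Q(A)`, the product of the forms of the hyperplanes of `A`. -/
noncomputable def definingPolynomial (A : CentralArrangement K l) : MvPolynomial (Fin l) K :=
  ∏ H ∈ A.hyperplanes, A.form H

/-- The Jacobian ideal `J(A)`, generated by `Q(A)` and all its partial derivatives. -/
noncomputable def jacobianIdeal (A : CentralArrangement K l) : Ideal (MvPolynomial (Fin l) K) :=
  Ideal.span ({A.definingPolynomial} ∪ Set.range (fun i => pderiv i A.definingPolynomial))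

/-- The module `D(A)` of logarithmic vector fields: the polynomial vector fields `δ` such that
`δ(α_H)` lies in the ideal generated by `α_H`, for every `H ∈ A`. -/
noncomputable def logDerivations (A : CentralArrangement K l) :
    Submodule (MvPolynomial (Fin l) K)
      (Derivation K (MvPolynomial (Fin l) K) (MvPolynomial (Fin l) K)) where
  carrier := {δ | ∀ H ∈ A.hyperplanes, δ (A.form H) ∈ Ideal.span {A.form H}}
  add_mem' ha hb H hH := Ideal.add_mem _ (ha H hH) (hb H hH)
  zero_mem' _ _ := Ideal.zero_mem _
  smul_mem' c _ hδ H hH := Ideal.mul_mem_left _ c (hδ H hH)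

/-- `A` is free with exponents `e`: the module `D(A)` has an `S`-basis `δ_1, …, δ_l` with `δ_i`
homogeneous of polynomial degree `e_i`, i.e. all the coefficients `δ_i(x_j)` are homogeneous
of degree `e_i`. -/
def IsFreeWithExponents (A : CentralArrangement K l) (e : Fin l → ℕ) : Prop :=
  ∃ b : Module.Basis (Fin l) (MvPolynomial (Fin l) K) A.logDerivations,
    ∀ i j, ((b i : Derivation K (MvPolynomial (Fin l) K) (MvPolynomial (Fin l) K))
      (X j)).IsHomogeneous (e i)

/-- `A` is free if it is free with some exponents. -/
def IsFree (A : CentralArrangement K l) : Prop :=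
  ∃ e : Fin l → ℕ, A.IsFreeWithExponents e

end CentralArrangement

/-! Let `g` be the product of the forms of the hyperplanes not containing `X`. Then `D(A) ⊆ D(A_X)`
and `g D(A_X) ⊆ D(A)`, so multiplication by `g` on `D(A_X)` factors through `D(A)`; likewise
multiplication by `g ^ 2` on `S/J(A_X)` factors through `S/J(A)`. For a fixed module `N`, the
scalars whose multiplication factors through a module of projective dimension `< n` form an ideal
(`scalarFactorIdeal`). If it contains `1`, then `N` is a retract of such a module and inherits the
bound.

To reach `1`, choose `p ∈ X` with `g(p) ≠ 0`. The substitutions `x ↦ p + c x` preserve `A_X`, hence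
also the ideal, which therefore contains `g(p + c x)` for every `c ≠ 0`. As `K` is infinite, it
contains each coefficient of the powers of `c`, in particular the nonzero constant `g(p)`.

Freeness is treated separately, because homogeneity of the basis must be recovered. Translating a
basis of `D(A)` by `p` gives fields in `D(A_X)` with determinant `Q(A_X)` times a polynomial not
vanishing at the origin. Suitable homogeneous components of these fields satisfy Saito's criterion
(`isFree_of_det_eq_mul`). -/

open CategoryTheory in
theorem hasProjectiveDimensionLT_map_of_isEquivalence {C D : Type*} [Category C] [Category D]
    [Abelian C] [Abelian D] [EnoughProjectives C] (F : C ⥤ D) [F.IsEquivalence] [F.Additive]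
    (n : ℕ) (M : C) (hM : HasProjectiveDimensionLT M n) :
    HasProjectiveDimensionLT (F.obj M) n := by
  -- Dimension shifting along a syzygy sequence starts at projective objects, the bound `1`; the
  -- bound `0` means a zero object and is handled apart.
  have key : ∀ n : ℕ, ∀ M : C, HasProjectiveDimensionLT M (n + 1) →
      HasProjectiveDimensionLT (F.obj M) (n + 1) := by
    intro n
    induction n with
    | zero =>
      intro M hM
      rw [zero_add] at hM ⊢
      have : Projective M := projective_iff_hasProjectiveDimensionLT_one.mpr hM
      exact projective_iff_hasProjectiveDimensionLT_one.mp
        ((F.asEquivalence.map_projective_iff M).mpr this)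
    | succ n ih =>
      intro M hM
      let T : ShortComplex C := ShortComplex.mk _ _ (Limits.kernel.condition (Projective.π M))
      have hT : T.ShortExact := { exact := ShortComplex.exact_kernel _ }
      have hFT : (T.map F).ShortExact := hT.map_of_exact F
      have hP : Projective (T.map F).X₂ :=
        (F.asEquivalence.map_projective_iff _).mpr (inferInstanceAs (Projective (Projective.over M)))
      exact (hFT.hasProjectiveDimensionLT_X₃_iff n hP).mpr (ih _
        ((hT.hasProjectiveDimensionLT_X₃_iff n
          (inferInstanceAs (Projective (Projective.over M)))).mp hM))
  cases n with
  | zero =>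
    rw [hasProjectiveDimensionLT_zero_iff_isZero] at hM ⊢
    exact F.map_isZero hM
  | succ n => exact key n M hM

/-! ### Scalars factoring through modules of small projective dimension -/

section ScalarFactorIdeal

open CategoryTheory
open scoped ZeroObject

universe u

variable {S : Type u} [CommRing S]

/-- The ideal of scalars `s` such that multiplication by `s` on `N` factors through a module of
projective dimension less than `n`. -/
noncomputable def scalarFactorIdeal (N : ModuleCat.{u} S) (n : ℕ) : Ideal S where
  carrier := {s | ∃ M : ModuleCat.{u} S, HasProjectiveDimensionLT M n ∧
    ∃ (h : N ⟶ M) (f : M ⟶ N), h ≫ f = s • 𝟙 N}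
  add_mem' := by
    rintro s t ⟨M, hM, h, f, hs⟩ ⟨M', hM', h', f', ht⟩
    exact ⟨M ⊞ M', inferInstance, Limits.biprod.lift h h', Limits.biprod.desc f f', by
      rw [Limits.biprod.lift_desc, hs, ht, add_smul]⟩
  zero_mem' := ⟨0, hasProjectiveDimensionLT_of_ge _ 0 n (Nat.zero_le n), 0, 0, by simp⟩
  smul_mem' := by
    rintro c s ⟨M, hM, h, f, hs⟩
    exact ⟨M, hM, h, c • f, by rw [Linear.comp_smul, hs, smul_smul, smul_eq_mul]⟩

theorem hasProjectiveDimensionLT_of_scalarFactorIdeal_eq_top {N : ModuleCat.{u} S} {n : ℕ}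
    (h : scalarFactorIdeal N n = ⊤) : HasProjectiveDimensionLT N n := by
  obtain ⟨M, hM, i, r, hir⟩ := (Ideal.eq_top_iff_one _).mp h
  exact Retract.hasProjectiveDimensionLT (Y := M) ⟨i, r, by rw [hir, one_smul]⟩ n

theorem mem_scalarFactorIdeal {N M : Type u} [AddCommGroup N] [Module S N] [AddCommGroup M]
    [Module S M] {n : ℕ} (hM : HasProjectiveDimensionLT (ModuleCat.of S M) n) {s : S}
    (h : N →ₗ[S] M) (f : M →ₗ[S] N) (hfh : ∀ x, f (h x) = s • x) :
    s ∈ scalarFactorIdeal (ModuleCat.of S N) n :=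
  ⟨ModuleCat.of S M, hM, ModuleCat.ofHom h, ModuleCat.ofHom f, by
    ext x
    exact hfh x⟩

/-- Restricting scalars along `σ⁻¹` is an equivalence, so it preserves projective dimension, and `e`
identifies `N` with its own twist. Twisting a factorization of `s` therefore yields one of `σ s`. -/
theorem map_mem_scalarFactorIdeal {N : Type u} [AddCommGroup N] [Module S N] {n : ℕ}
    (σ : S ≃+* S) (e : N ≃+ N) (he : ∀ (s : S) (x : N), e (s • x) = σ s • e x) {s : S}
    (hs : s ∈ scalarFactorIdeal (ModuleCat.of S N) n) :
    σ s ∈ scalarFactorIdeal (ModuleCat.of S N) n := by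
  obtain ⟨M, hM, h, f, hfh⟩ := hs
  have he' : ∀ (s : S) (x : N), e.symm (s • x) = σ.symm s • e.symm x := fun s x => by
    apply e.injective
    simp [he]
  let F := ModuleCat.restrictScalars.{u} σ.symm.toRingHom
  let a : ModuleCat.of S N ⟶ F.obj (ModuleCat.of S N) := ModuleCat.ofHom
    (Y := F.obj (ModuleCat.of S N))
    { toFun := fun x => (e.symm x : N)
      map_add' := fun x y => e.symm.map_add x y
      map_smul' := fun s x => he' s x }
  let b : F.obj (ModuleCat.of S N) ⟶ ModuleCat.of S N := ModuleCat.ofHom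
    (X := F.obj (ModuleCat.of S N))
    { toFun := fun x => e (x : N)
      map_add' := fun x y => e.map_add (x : N) (y : N)
      map_smul' := fun s x => (he (σ.symm s) (x : N)).trans (by simp) }
  have : F.IsEquivalence := ModuleCat.restrictScalars_isEquivalence_of_ringEquiv σ.symm
  refine ⟨F.obj M, hasProjectiveDimensionLT_map_of_isEquivalence F n M hM,
    a ≫ F.map h, F.map f ≫ b, ?_⟩
  ext x
  have h1 : ∀ y : N, f (h y) = s • y := fun y => by
    have := congrArg (fun φ : ModuleCat.of S N ⟶ ModuleCat.of S N => φ y) hfh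
    simpa using this
  change e (f (h (e.symm x))) = σ s • x
  rw [h1]
  simp [he]

end ScalarFactorIdeal

/-! ### Affine substitutions and extraction of a constant term -/

section AffineChange

variable {K : Type*} [Field K] {ι : Type*}

/-- The automorphism `x ↦ p + c x` of the polynomial ring. -/
noncomputable def affineAut (p : ι → K) (c : Kˣ) : MvPolynomial ι K ≃ₐ[K] MvPolynomial ι K :=
  AlgEquiv.ofAlgHom (aeval fun i => C (p i) + C (c : K) * X i)
    (aeval fun i => C ((c⁻¹ : Kˣ) : K) * (X i - C (p i)))
    (by
      ext i : 1
      simp only [AlgHom.comp_apply, aeval_X, map_mul, map_sub, algHom_C, algebraMap_eq,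
        AlgHom.id_apply]
      rw [add_sub_cancel_left, ← mul_assoc, ← C_mul, Units.inv_mul, C_1, one_mul])
    (by
      ext i : 1
      simp only [AlgHom.comp_apply, aeval_X, map_add, map_mul, algHom_C, algebraMap_eq,
        AlgHom.id_apply]
      rw [← mul_assoc, ← C_mul, Units.mul_inv, C_1, one_mul, add_sub_cancel])

theorem affineAut_X (p : ι → K) (c : Kˣ) (i : ι) :
    affineAut p c (X i) = C (p i) + C (c : K) * X i := by
  simp [affineAut]

theorem affineAut_C (p : ι → K) (c : Kˣ) (a : K) : affineAut p c (C a) = C a :=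
  (affineAut p c).commutes a

theorem eval_affineAut (p v : ι → K) (c : Kˣ) (f : MvPolynomial ι K) :
    eval v (affineAut p c f) = eval (fun i => p i + c * v i) f := by
  induction f using MvPolynomial.induction_on with
  | C a => simp [affineAut_C]
  | add f g hf hg => simp [hf, hg]
  | mul_X f i hf => simp [hf, affineAut_X]

/-- Translating first and scaling second makes the dependence on `c` polynomial, with coefficients
that do not involve `c`. -/
theorem affineAut_eq_sum (p : ι → K) (c : Kˣ) (f : MvPolynomial ι K) :
    affineAut p c f = ∑ d ∈ Finset.range ((affineAut p 1 f).totalDegree + 1),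
      (c : K) ^ d • homogeneousComponent d (affineAut p 1 f) := by
  have key : ∀ g : MvPolynomial ι K, affineAut 0 c g = ∑ d ∈ Finset.range (g.totalDegree + 1),
      (c : K) ^ d • homogeneousComponent d g := by
    intro g
    conv_lhs => rw [← sum_homogeneousComponent g, map_sum]
    refine Finset.sum_congr rfl fun d _ => ?_
    have hh := homogeneousComponent_isHomogeneous d g
    generalize homogeneousComponent d g = q at hh
    rw [q.as_sum, map_sum, Finset.smul_sum]
    refine Finset.sum_congr rfl fun m hm => ?_
    have hd : m.degree = d := by
      rw [Finsupp.degree_eq_weight_one]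
      exact hh (mem_support_iff.mp hm)
    rw [monomial_eq, map_mul, affineAut_C, smul_eq_C_mul, mul_left_comm]
    congr 1
    simp only [Finsupp.prod, map_prod, map_pow, affineAut_X, Pi.zero_apply, C_0, zero_add, mul_pow,
      Finset.prod_mul_distrib]
    rw [Finset.prod_pow_eq_pow_sum, ← hd, Finsupp.degree_apply]
  rw [← key]
  have : (affineAut p c).toAlgHom =
      (affineAut 0 c).toAlgHom.comp
        (affineAut p 1).toAlgHom := by
    ext i : 1
    simp [affineAut_X, affineAut_C]
  exact DFunLike.congr_fun this f

/-- A Vandermonde argument without matrices: each linear functional turns the sum into a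
one-variable polynomial vanishing at every nonzero scalar. -/
theorem eq_zero_of_forall_sum_pow_smul_eq_zero [Infinite K] {V : Type*} [AddCommGroup V]
    [Module K V] (n : ℕ) (v : ℕ → V)
    (h : ∀ c : Kˣ, ∑ d ∈ Finset.range n, (c : K) ^ d • v d = 0) :
    ∀ d < n, v d = 0 := by
  intro d hd
  rw [← Module.forall_dual_apply_eq_zero_iff K]
  intro φ
  let P : Polynomial K := ∑ d ∈ Finset.range n, Polynomial.monomial d (φ (v d))
  have hP : P = 0 := by
    apply Polynomial.eq_zero_of_infinite_isRoot
    refine ((Set.finite_singleton (0 : K)).infinite_compl).mono fun c hc => ?_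
    have := congrArg φ (h (Units.mk0 c hc))
    simp only [map_sum, map_smul, map_zero, smul_eq_mul] at this
    simp only [P, Polynomial.IsRoot.def, Set.mem_ofPred_eq, Polynomial.eval_finsetSum,
      Polynomial.eval_monomial]
    simp only [mul_comm (φ _)]
    exact this
  have := congrArg (fun Q => Polynomial.coeff Q d) hP
  simpa [P, Polynomial.finsetSum_coeff, Polynomial.coeff_monomial, hd] using this

theorem ideal_eq_top_of_forall_affineAut_mem [Infinite K] (I : Ideal (MvPolynomial ι K))
    (p : ι → K) (f : MvPolynomial ι K) (hp : eval p f ≠ 0) (h : ∀ c, affineAut p c f ∈ I) :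
    I = ⊤ := by
  -- Working modulo `I` turns membership into vanishing. Only the degree `0` component is needed: it
  -- is the constant `f(p)`.
  have h0 := eq_zero_of_forall_sum_pow_smul_eq_zero (K := K) (V := MvPolynomial ι K ⧸ I)
    ((affineAut p 1 f).totalDegree + 1)
    (fun d => Ideal.Quotient.mkₐ K I (homogeneousComponent d (affineAut p 1 f)))
    (fun c => by
      refine Eq.trans ?_ (Ideal.Quotient.eq_zero_iff_mem.mpr (h c))
      rw [affineAut_eq_sum p c, ← Ideal.Quotient.mkₐ_eq_mk K, map_sum]
      simp only [map_smul]) 0 (Nat.succ_pos _)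
  have h1 : C (coeff 0 (affineAut p 1 f)) ∈ I := by
    rw [← homogeneousComponent_zero]
    exact Ideal.Quotient.eq_zero_iff_mem.mp h0
  have h2 : coeff 0 (affineAut p 1 f) = eval p f := by
    have := eval_affineAut p 0 1 f
    rw [eval_zero, constantCoeff_eq] at this
    simpa using this
  rw [h2] at h1
  exact Ideal.eq_top_of_isUnit_mem _ h1 ((isUnit_iff_ne_zero.mpr hp).map C)

end AffineChange

/-! ### Conjugation of derivations; linear forms under affine substitutions -/

section Derivations

variable {K R : Type*} [CommRing K] [CommRing R] [Algebra K R]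

/-- The conjugate `σ ∘ δ ∘ σ⁻¹` of a derivation by an automorphism. -/
def conjDerivation (σ : R ≃ₐ[K] R) (δ : Derivation K R R) : Derivation K R R where
  toLinearMap := σ.toLinearMap ∘ₗ δ.toLinearMap ∘ₗ σ.symm.toLinearMap
  map_one_eq_zero' := by simp
  leibniz' a b := by simp

theorem conjDerivation_apply (σ : R ≃ₐ[K] R) (δ : Derivation K R R) (a : R) :
    conjDerivation σ δ a = σ (δ (σ.symm a)) := rfl

theorem derivation_sum_apply {ι : Type*} (s : Finset ι) (δ : ι → Derivation K R R) (a : R) :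
    (∑ i ∈ s, δ i) a = ∑ i ∈ s, δ i a := by
  have := congrFun (map_sum (Derivation.coeFnAddMonoidHom (R := K) (A := R) (M := R)) δ s) a
  exact this.trans (Finset.sum_apply a s _)

theorem derivation_mem_span_of_associated {δ : Derivation K R R} {a b : R} (hab : Associated a b)
    (ha : δ a ∈ Ideal.span {a}) : δ b ∈ Ideal.span {b} := by
  obtain ⟨u, rfl⟩ := hab
  rw [Ideal.mem_span_singleton] at ha ⊢
  rw [Derivation.leibniz, smul_eq_mul, smul_eq_mul]
  refine dvd_add (Units.mul_right_dvd.mpr (Dvd.intro _ rfl)) ?_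
  rw [mul_comm a]
  exact mul_dvd_mul_left _ ha

theorem conjDerivation_mem_span {σ : R ≃ₐ[K] R} {δ : Derivation K R R} {a : R}
    (hσ : Associated (σ a) a) (ha : δ a ∈ Ideal.span {a}) :
    conjDerivation σ δ a ∈ Ideal.span {a} := by
  have h1 : Associated a (σ.symm a) := by simpa using hσ.map σ.symm
  have h2 := derivation_mem_span_of_associated h1 ha
  rw [Ideal.mem_span_singleton] at h2 ⊢
  simpa [conjDerivation_apply] using map_dvd σ h2

end Derivations

section MvPolynomialAux

variable {K : Type*} [CommRing K] {ι : Type*} [Fintype ι]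

theorem derivation_eq_sum_pderiv (δ : Derivation K (MvPolynomial ι K) (MvPolynomial ι K))
    (f : MvPolynomial ι K) : δ f = ∑ i, δ (X i) * pderiv i f := by
  classical
  have : δ = ∑ i, δ (X i) • pderiv i := by
    refine derivation_ext fun j => ?_
    rw [derivation_sum_apply]
    simp [pderiv_X, Pi.single_apply]
  conv_lhs => rw [this, derivation_sum_apply]
  rfl

theorem MvPolynomial.IsHomogeneous.eq_sum_coeff_mul_X {f : MvPolynomial ι K}
    (hf : f.IsHomogeneous 1) : f = ∑ i, C (coeff (Finsupp.single i 1) f) * X i := by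
  classical
  have h : f ∈ homogeneousSubmodule ι K 1 := hf
  rw [homogeneousSubmodule_one_eq_span_X] at h
  induction h using Submodule.span_induction with
  | mem x hx =>
    obtain ⟨j, rfl⟩ := hx
    simp [coeff_X, Finsupp.single_left_inj, Finset.sum_ite_eq]
  | zero => simp
  | add x y hx hy ihx ihy =>
    rw [← homogeneousSubmodule_one_eq_span_X] at hx hy
    conv_lhs => rw [ihx hx, ihy hy, ← Finset.sum_add_distrib]
    simp [add_mul]
  | smul a x hx ihx =>
    rw [← homogeneousSubmodule_one_eq_span_X] at hx
    conv_lhs => rw [ihx hx, Finset.smul_sum]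
    simp [smul_eq_C_mul, mul_assoc]

end MvPolynomialAux

theorem affineAut_of_isHomogeneous_one {K ι : Type*} [Field K] [Fintype ι] (p : ι → K) (c : Kˣ)
    {f : MvPolynomial ι K} (hf : f.IsHomogeneous 1) :
    affineAut p c f = C (eval p f) + C (c : K) * f := by
  obtain ⟨a, rfl⟩ : ∃ a : ι → K, f = ∑ i, C (a i) * X i := ⟨_, hf.eq_sum_coeff_mul_X⟩
  simp only [map_sum, map_mul, affineAut_C, affineAut_X, mul_add, Finset.sum_add_distrib, eval_C,
    eval_X, Finset.mul_sum, mul_left_comm]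

/-! ### Automorphisms preserving an arrangement -/

namespace CentralArrangement

variable {K : Type*} [Field K] {l : ℕ}

theorem derivation_mem_jacobianIdeal (A : CentralArrangement K l)
    (δ : Derivation K (MvPolynomial (Fin l) K) (MvPolynomial (Fin l) K)) :
    δ A.definingPolynomial ∈ A.jacobianIdeal := by
  rw [derivation_eq_sum_pderiv]
  exact Ideal.sum_mem _ fun i _ => Ideal.mul_mem_left _ _
    (Ideal.subset_span (Or.inr ⟨i, rfl⟩))

theorem definingPolynomial_mem_jacobianIdeal (A : CentralArrangement K l) :
    A.definingPolynomial ∈ A.jacobianIdeal :=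
  Ideal.subset_span (Or.inl rfl)

/-- An automorphism preserves an arrangement if it rescales all of its forms. -/
def IsPreservedBy (A : CentralArrangement K l)
    (σ : MvPolynomial (Fin l) K ≃ₐ[K] MvPolynomial (Fin l) K) : Prop :=
  ∀ H ∈ A.hyperplanes, Associated (σ (A.form H)) (A.form H)

namespace IsPreservedBy

variable {A : CentralArrangement K l} {σ : MvPolynomial (Fin l) K ≃ₐ[K] MvPolynomial (Fin l) K}

theorem symm (h : A.IsPreservedBy σ) : A.IsPreservedBy σ.symm := fun H hH => by
  simpa using ((h H hH).map σ.symm).symm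

theorem associated_definingPolynomial (h : A.IsPreservedBy σ) :
    Associated (σ A.definingPolynomial) A.definingPolynomial := by
  rw [definingPolynomial, map_prod]
  exact Associated.prod _ _ _ h

/-- Conjugation by `σ` sends `∂ᵢ` to another derivation, and `σ Q` is a unit times `Q`. So `σ (∂ᵢ
Q)` is a derivation applied to a multiple of `Q`, which lies in the ideal by the Leibniz rule. -/
theorem map_jacobianIdeal_le (h : A.IsPreservedBy σ) :
    A.jacobianIdeal.map σ ≤ A.jacobianIdeal := by
  obtain ⟨u, hu⟩ := h.associated_definingPolynomial.symm
  rw [Ideal.map_le_iff_le_comap, jacobianIdeal, Ideal.span_le]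
  rintro f (rfl | ⟨i, rfl⟩)
  · rw [SetLike.mem_coe, Ideal.mem_comap, ← hu]
    exact Ideal.mul_mem_right _ _ A.definingPolynomial_mem_jacobianIdeal
  · have : σ (pderiv i A.definingPolynomial) =
        conjDerivation σ (pderiv i) (σ A.definingPolynomial) := by simp [conjDerivation_apply]
    rw [SetLike.mem_coe, Ideal.mem_comap, this, ← hu, Derivation.leibniz]
    exact Ideal.add_mem _ (Ideal.mul_mem_right _ _ A.definingPolynomial_mem_jacobianIdeal)
      (Ideal.mul_mem_left _ _ (A.derivation_mem_jacobianIdeal _))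

theorem map_jacobianIdeal (h : A.IsPreservedBy σ) :
    A.jacobianIdeal = A.jacobianIdeal.map (σ : MvPolynomial (Fin l) K →+* MvPolynomial (Fin l) K) := by
  refine le_antisymm (fun f hf => ?_) h.map_jacobianIdeal_le
  have h1 := h.symm.map_jacobianIdeal_le (Ideal.mem_map_of_mem _ hf)
  simpa using Ideal.mem_map_of_mem (σ : MvPolynomial (Fin l) K →+* MvPolynomial (Fin l) K) h1

theorem conjDerivation_mem (h : A.IsPreservedBy σ)
    {δ : Derivation K (MvPolynomial (Fin l) K) (MvPolynomial (Fin l) K)}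
    (hδ : δ ∈ A.logDerivations) : conjDerivation σ δ ∈ A.logDerivations :=
  fun H hH => conjDerivation_mem_span (h H hH) (hδ H hH)

/-- The semilinear automorphism of the module of logarithmic vector fields. -/
noncomputable def logDerivationsEquiv (h : A.IsPreservedBy σ) :
    A.logDerivations ≃+ A.logDerivations where
  toFun δ := ⟨conjDerivation σ δ, h.conjDerivation_mem δ.2⟩
  invFun δ := ⟨conjDerivation σ.symm δ, h.symm.conjDerivation_mem δ.2⟩
  left_inv δ := by ext; simp [conjDerivation_apply]
  right_inv δ := by ext; simp [conjDerivation_apply]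
  map_add' δ ε := by ext; simp [conjDerivation_apply]

end IsPreservedBy

theorem isPreservedBy_affineAut (A : CentralArrangement K l) {p : Fin l → K}
    (hp : ∀ H ∈ A.hyperplanes, p ∈ H) (c : Kˣ) : A.IsPreservedBy (affineAut p c) := by
  intro H hH
  rw [affineAut_of_isHomogeneous_one p c (A.form_isHomogeneous H hH),
    (A.mem_iff_eval_form H hH p).mp (hp H hH), C_0, zero_add]
  exact associated_unit_mul_left _ _ (c.isUnit.map C)

/-! ### Comparison of an arrangement with its localization -/

variable (A : CentralArrangement K l) (X : Submodule K (Fin l → K))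

open Classical in
/-- The product of the forms of the hyperplanes which do not contain `X`. -/
noncomputable def residualPolynomial : MvPolynomial (Fin l) K :=
  ∏ H ∈ A.hyperplanes.filter (fun H => ¬ X ≤ H), A.form H

theorem localization_definingPolynomial_mul :
    (A.localization X).definingPolynomial * A.residualPolynomial X = A.definingPolynomial := by
  classical
  exact Finset.prod_filter_mul_prod_filter_not _ _ _

theorem mem_localization_hyperplanes {H : Submodule K (Fin l → K)} :
    H ∈ (A.localization X).hyperplanes ↔ H ∈ A.hyperplanes ∧ X ≤ H := by
  classical
  exact Finset.mem_filter

theorem logDerivations_le_localization :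
    A.logDerivations ≤ (A.localization X).logDerivations :=
  fun _ hδ H hH => hδ H ((A.mem_localization_hyperplanes X).mp hH).1

theorem residualPolynomial_smul_mem
    {δ : Derivation K (MvPolynomial (Fin l) K) (MvPolynomial (Fin l) K)}
    (hδ : δ ∈ (A.localization X).logDerivations) :
    A.residualPolynomial X • δ ∈ A.logDerivations := by
  classical
  intro H hH
  rw [Derivation.smul_apply, smul_eq_mul]
  by_cases hXH : X ≤ H
  · exact Ideal.mul_mem_left _ _ (hδ H ((A.mem_localization_hyperplanes X).mpr ⟨hH, hXH⟩))
  · exact Ideal.mul_mem_right _ _ (Ideal.mem_span_singleton.mpr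
      (Finset.dvd_prod_of_mem _ (Finset.mem_filter.mpr ⟨hH, hXH⟩)))

theorem jacobianIdeal_le_localization :
    A.jacobianIdeal ≤ (A.localization X).jacobianIdeal := by
  rw [jacobianIdeal, Ideal.span_le]
  rintro f (rfl | ⟨i, rfl⟩)
  · rw [← A.localization_definingPolynomial_mul X]
    exact Ideal.mul_mem_right _ _ (definingPolynomial_mem_jacobianIdeal _)
  · dsimp only
    rw [← A.localization_definingPolynomial_mul X, SetLike.mem_coe, Derivation.leibniz]
    exact Ideal.add_mem _ (Ideal.mul_mem_right _ _ (definingPolynomial_mem_jacobianIdeal _))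
      (Ideal.mul_mem_left _ _ (derivation_mem_jacobianIdeal _ _))

/-- The square comes from the Leibniz rule: `g ∂q = ∂(q g) - q ∂g`, and another factor `g` turns the
last term into a multiple of `Q = q g`. -/
theorem residualPolynomial_sq_mul_mem {f : MvPolynomial (Fin l) K}
    (hf : f ∈ (A.localization X).jacobianIdeal) :
    A.residualPolynomial X ^ 2 * f ∈ A.jacobianIdeal := by
  set g := A.residualPolynomial X
  set q := (A.localization X).definingPolynomial
  have hQ : q * g = A.definingPolynomial := A.localization_definingPolynomial_mul X
  have hmem := A.definingPolynomial_mem_jacobianIdeal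
  suffices (A.localization X).jacobianIdeal ≤
      Submodule.comap (LinearMap.mulLeft _ (g ^ 2)) A.jacobianIdeal from this hf
  rw [jacobianIdeal, Ideal.span_le]
  rintro f (rfl | ⟨i, rfl⟩)
  · change g ^ 2 * q ∈ A.jacobianIdeal
    rw [show g ^ 2 * q = g * (q * g) by ring, hQ]
    exact Ideal.mul_mem_left _ _ hmem
  · change g ^ 2 * pderiv i q ∈ A.jacobianIdeal
    have : g ^ 2 * pderiv i q = g * pderiv i (q * g) - pderiv i g * (q * g) := by
      rw [Derivation.leibniz, smul_eq_mul, smul_eq_mul]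
      ring
    rw [this, hQ]
    exact Ideal.sub_mem _ (Ideal.mul_mem_left _ _ (derivation_mem_jacobianIdeal _ _))
      (Ideal.mul_mem_left _ _ hmem)

/-- The hyperplanes not containing `X` cut it in proper subspaces, and over an infinite field
finitely many of these cannot cover `X`. -/
theorem exists_mem_eval_residualPolynomial_ne_zero [Infinite K] :
    ∃ p ∈ X, eval p (A.residualPolynomial X) ≠ 0 := by
  classical
  let s : Finset (Submodule K X) :=
    (A.hyperplanes.filter fun H => ¬ X ≤ H).image fun H => H.comap X.subtype
  have hs : ⊤ ∉ s := by
    intro h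
    obtain ⟨H, hH, hHt⟩ := Finset.mem_image.mp h
    exact (Finset.mem_filter.mp hH).2 (Submodule.comap_subtype_eq_top.mp hHt)
  have := Subspace.biUnion_ne_univ_of_top_notMem hs
  obtain ⟨p, hp⟩ := (Set.ne_univ_iff_exists_notMem _).mp this
  refine ⟨p, p.2, ?_⟩
  rw [residualPolynomial, map_prod, Finset.prod_ne_zero_iff]
  intro H hH h0
  refine hp (Set.mem_biUnion (Finset.mem_coe.mpr (Finset.mem_image_of_mem _ hH)) ?_)
  exact (A.mem_iff_eval_form H (Finset.mem_filter.mp hH).1 p).mpr h0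

theorem localization_isPreservedBy_affineAut {p : Fin l → K} (hp : p ∈ X) (c : Kˣ) :
    (A.localization X).IsPreservedBy (affineAut p c) :=
  isPreservedBy_affineAut _ (fun _ hH => ((A.mem_localization_hyperplanes X).mp hH).2 hp) c

theorem hasProjectiveDimensionLT_logDerivations_localization [Infinite K] (n : ℕ)
    (h : CategoryTheory.HasProjectiveDimensionLT
      (ModuleCat.of (MvPolynomial (Fin l) K) A.logDerivations) n) :
    CategoryTheory.HasProjectiveDimensionLT
      (ModuleCat.of (MvPolynomial (Fin l) K) (A.localization X).logDerivations) n := by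
  obtain ⟨p, hp, hgp⟩ := A.exists_mem_eval_residualPolynomial_ne_zero X
  refine hasProjectiveDimensionLT_of_scalarFactorIdeal_eq_top
    (ideal_eq_top_of_forall_affineAut_mem _ p _ hgp fun c => ?_)
  have hσ := A.localization_isPreservedBy_affineAut X hp c
  refine map_mem_scalarFactorIdeal (affineAut p c).toRingEquiv hσ.logDerivationsEquiv
    (fun s δ => ?_) ?_
  · ext
    simp [IsPreservedBy.logDerivationsEquiv, conjDerivation_apply]
  · exact mem_scalarFactorIdeal h
      ((LinearMap.lsmul _ _ (A.residualPolynomial X) ∘ₗ Submodule.subtype _).codRestrict _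
        fun δ => A.residualPolynomial_smul_mem X δ.2)
      (Submodule.inclusion (A.logDerivations_le_localization X)) fun δ => rfl

theorem hasProjectiveDimensionLT_quotient_localization [Infinite K] (n : ℕ)
    (h : CategoryTheory.HasProjectiveDimensionLT (ModuleCat.of (MvPolynomial (Fin l) K)
      (MvPolynomial (Fin l) K ⧸ A.jacobianIdeal)) n) :
    CategoryTheory.HasProjectiveDimensionLT (ModuleCat.of (MvPolynomial (Fin l) K)
      (MvPolynomial (Fin l) K ⧸ (A.localization X).jacobianIdeal)) n := by
  obtain ⟨p, hp, hgp⟩ := A.exists_mem_eval_residualPolynomial_ne_zero X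
  refine hasProjectiveDimensionLT_of_scalarFactorIdeal_eq_top
    (ideal_eq_top_of_forall_affineAut_mem _ p (A.residualPolynomial X ^ 2)
      (by rw [map_pow]; exact pow_ne_zero 2 hgp) fun c => ?_)
  have hσ := A.localization_isPreservedBy_affineAut X hp c
  refine map_mem_scalarFactorIdeal (affineAut p c).toRingEquiv
    (Ideal.quotientEquiv _ _ (affineAut p c).toRingEquiv hσ.map_jacobianIdeal).toAddEquiv
    (fun s f => ?_) ?_
  · obtain ⟨f, rfl⟩ := Ideal.Quotient.mk_surjective f
    change Ideal.Quotient.mk _ (affineAut p c (s * f)) = _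
    rw [map_mul]
    rfl
  · refine mem_scalarFactorIdeal h
      (Submodule.mapQ _ _ (LinearMap.mulLeft _ (A.residualPolynomial X ^ 2))
        fun f hf => A.residualPolynomial_sq_mul_mem X hf)
      (Submodule.mapQ _ _ LinearMap.id (A.jacobianIdeal_le_localization X)) fun f => ?_
    obtain ⟨f, rfl⟩ := Submodule.Quotient.mk_surjective _ f
    rfl

end CentralArrangement

theorem CategoryTheory.projectiveDimension_le_of_forall_hasProjectiveDimensionLT {C D : Type*}
    [Category C] [Category D] [Abelian C] [Abelian D] {M : C} {N : D}
    (h : ∀ n, HasProjectiveDimensionLT M n → HasProjectiveDimensionLT N n) :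
    projectiveDimension N ≤ projectiveDimension M :=
  sInf_le_sInf fun _ hn i hi => h i (hn i hi)

/-! ### Homogeneous components, linear forms and determinants -/

section LinearForms

variable {K : Type*} [Field K] {ι : Type*}

theorem exists_coeff_single_ne_zero [Fintype ι] {f : MvPolynomial ι K} (hf : f.IsHomogeneous 1)
    (h0 : f ≠ 0) : ∃ i, coeff (Finsupp.single i 1) f ≠ 0 := by
  by_contra! h
  refine h0 (hf.eq_sum_coeff_mul_X.trans ?_)
  simp [h]

theorem irreducible_of_isHomogeneous_one [Fintype ι] {f : MvPolynomial ι K}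
    (hf : f.IsHomogeneous 1) (h0 : f ≠ 0) : Irreducible f := by
  obtain ⟨i, hi⟩ := exists_coeff_single_ne_zero hf h0
  exact irreducible_of_totalDegree_eq_one (hf.totalDegree h0) fun x hx =>
    isUnit_of_dvd_unit (hx _) (isUnit_iff_ne_zero.mpr hi)

theorem derivation_apply_of_isHomogeneous_one [Fintype ι]
    (δ : Derivation K (MvPolynomial ι K) (MvPolynomial ι K)) {f : MvPolynomial ι K}
    (hf : f.IsHomogeneous 1) : δ f = ∑ j, C (coeff (Finsupp.single j 1) f) * δ (X j) := by
  conv_lhs => rw [hf.eq_sum_coeff_mul_X]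
  rw [map_sum]
  exact Finset.sum_congr rfl fun j _ => by
    rw [← smul_eq_C_mul, Derivation.map_smul, smul_eq_C_mul]

theorem homogeneousComponent_mul_of_isHomogeneous {q h : MvPolynomial ι K} {m : ℕ}
    (hq : q.IsHomogeneous m) (k : ℕ) :
    homogeneousComponent (m + k) (q * h) = q * homogeneousComponent k h := by
  conv_lhs => rw [← sum_homogeneousComponent h, Finset.mul_sum, map_sum]
  have : ∀ d, homogeneousComponent (m + k) (q * homogeneousComponent d h) =
      if k = d then q * homogeneousComponent d h else 0 := fun d => by
    rw [homogeneousComponent_of_mem (hq.mul (homogeneousComponent_isHomogeneous d h))]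
    simp only [add_right_inj]
  simp only [this, Finset.sum_ite_eq]
  split_ifs with hk
  · rfl
  · rw [homogeneousComponent_eq_zero _ _ (by simpa using hk), mul_zero]

theorem dvd_homogeneousComponent {q f : MvPolynomial ι K} {m : ℕ} (hq : q.IsHomogeneous m)
    (hf : q ∣ f) (n : ℕ) : q ∣ homogeneousComponent n f := by
  obtain ⟨h, rfl⟩ := hf
  rcases le_or_gt m n with hmn | hmn
  · obtain ⟨k, rfl⟩ := Nat.exists_eq_add_of_le hmn
    exact ⟨_, homogeneousComponent_mul_of_isHomogeneous hq k⟩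
  · rw [← sum_homogeneousComponent h, Finset.mul_sum, map_sum]
    refine Finset.dvd_sum fun d _ => ?_
    rw [homogeneousComponent_of_mem (hq.mul (homogeneousComponent_isHomogeneous d h)),
      if_neg (by omega)]
    exact dvd_zero q

/-- The homogeneous component of a polynomial vector field in polynomial degree `n`. -/
noncomputable def derivationComponent (n : ℕ)
    (δ : Derivation K (MvPolynomial ι K) (MvPolynomial ι K)) :
    Derivation K (MvPolynomial ι K) (MvPolynomial ι K) :=
  mkDerivation K fun j => homogeneousComponent n (δ (X j))

theorem derivationComponent_X (n : ℕ) (δ : Derivation K (MvPolynomial ι K) (MvPolynomial ι K))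
    (j : ι) : derivationComponent n δ (X j) = homogeneousComponent n (δ (X j)) :=
  mkDerivation_X _ _ _

theorem derivationComponent_apply [Fintype ι] (n : ℕ)
    (δ : Derivation K (MvPolynomial ι K) (MvPolynomial ι K)) {f : MvPolynomial ι K}
    (hf : f.IsHomogeneous 1) :
    derivationComponent n δ f = homogeneousComponent n (δ f) := by
  rw [derivation_apply_of_isHomogeneous_one _ hf, derivation_apply_of_isHomogeneous_one δ hf,
    map_sum]
  simp only [derivationComponent_X, homogeneousComponent_C_mul]

/-- The matrix of coefficients of a family of polynomial vector fields. -/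
noncomputable def coeffMatrix {κ : Type*} (θ : κ → Derivation K (MvPolynomial ι K) (MvPolynomial ι K)) :
    Matrix κ ι (MvPolynomial ι K) :=
  Matrix.of fun i j => θ i (X j)

theorem coeffMatrix_apply {κ : Type*}
    (θ : κ → Derivation K (MvPolynomial ι K) (MvPolynomial ι K)) (i : κ) (j : ι) :
    coeffMatrix θ i j = θ i (X j) := rfl

end LinearForms

/-- If some entry of `v` is a unit and all entries of `M v` are divisible by `a`, then `a` divides
the determinant of `M`. -/
theorem Matrix.dvd_det_of_forall_dvd_mulVec {R n : Type*} [CommRing R] [Fintype n] [DecidableEq n]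
    (M : Matrix n n R) {v : n → R} {j : n} (hj : IsUnit (v j)) {a : R}
    (h : ∀ i, a ∣ (M.mulVec v) i) : a ∣ M.det := by
  have h1 : M.adjugate.mulVec (M.mulVec v) = M.det • v := by
    rw [Matrix.mulVec_mulVec, Matrix.adjugate_mul, Matrix.smul_mulVec, Matrix.one_mulVec]
  have h2 : a ∣ M.det * v j := by
    rw [← smul_eq_mul, ← Pi.smul_apply, ← h1]
    exact Finset.dvd_sum fun i _ => (h i).mul_left _
  exact hj.dvd_mul_right.mp h2

/-- Expansion of the determinant of a matrix whose entries are sums. -/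
theorem Matrix.det_of_sum {R n κ : Type*} [CommRing R] [Fintype n] [DecidableEq n] (s : Finset κ)
    (g : κ → Matrix n n R) :
    (Matrix.of fun i j => ∑ d ∈ s, g d i j).det =
      ∑ e ∈ Fintype.piFinset fun _ : n => s, (Matrix.of fun i j => g (e i) i j).det := by
  have := (Matrix.detRowAlternating (n := n) (R := R)).toMultilinearMap.map_sum_finset
    (fun i d => g d i) (fun _ => s)
  refine Eq.trans (congrArg Matrix.det ?_) this
  ext i j
  simp [Finset.sum_apply]

theorem isHomogeneous_det {K ι n : Type*} [CommRing K] [Fintype n] [DecidableEq n]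
    (M : Matrix n n (MvPolynomial ι K)) (e : n → ℕ) (h : ∀ i j, (M i j).IsHomogeneous (e i)) :
    M.det.IsHomogeneous (∑ i, e i) := by
  rw [← Matrix.det_transpose, Matrix.det_apply]
  refine IsHomogeneous.sum _ _ _ fun σ _ => ?_
  have := IsHomogeneous.prod Finset.univ (fun i => M.transpose (σ i) i) e fun i _ => h i (σ i)
  rcases Int.units_eq_one_or (Equiv.Perm.sign σ) with hs | hs
  · simpa [hs] using this
  · simpa [hs] using this.neg

/-- Split every row into homogeneous parts and expand by multilinearity. Each summand is homogeneous
of degree `∑ i, e i`, so a nonzero degree `N` part forces a nonzero summand of that degree. -/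
theorem exists_det_homogeneousComponent_ne_zero {K ι n : Type*} [Field K] [Fintype n]
    [DecidableEq n] (M : Matrix n n (MvPolynomial ι K)) (N : ℕ)
    (h : homogeneousComponent N M.det ≠ 0) :
    ∃ e : n → ℕ, ∑ i, e i = N ∧
      (Matrix.of fun i j => homogeneousComponent (e i) (M i j)).det ≠ 0 := by
  let D : ℕ := Finset.univ.sup fun ij : n × n => (M ij.1 ij.2).totalDegree + 1
  have hM : M = Matrix.of fun i j => ∑ d ∈ Finset.range D, homogeneousComponent d (M i j) := by
    ext1 i j
    rw [Matrix.of_apply]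
    conv_lhs => rw [← sum_homogeneousComponent (M i j)]
    refine Finset.sum_subset (Finset.range_subset_range.mpr
      (Finset.le_sup (f := fun ij : n × n => (M ij.1 ij.2).totalDegree + 1)
        (Finset.mem_univ (i, j)))) fun d _ hd => homogeneousComponent_eq_zero _ _ ?_
    simpa using hd
  have hdet := (congrArg Matrix.det hM).trans (Matrix.det_of_sum (Finset.range D)
    fun d => Matrix.of fun i j => homogeneousComponent d (M i j))
  rw [hdet, map_sum] at h
  obtain ⟨e, -, he⟩ := Finset.exists_ne_zero_of_sum_ne_zero h
  have hh := isHomogeneous_det (Matrix.of fun i j => homogeneousComponent (e i) (M i j)) e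
    fun i j => homogeneousComponent_isHomogeneous _ _
  change homogeneousComponent N (Matrix.of fun i j => homogeneousComponent (e i) (M i j)).det ≠ 0
    at he
  rw [homogeneousComponent_of_mem hh] at he
  exact ⟨e, (ite_ne_right_iff.mp he).1.symm, (ite_ne_right_iff.mp he).2⟩

/-! ### Saito's criterion -/

namespace CentralArrangement

variable {K : Type*} [Field K] {l : ℕ} (A : CentralArrangement K l)

variable {A} in
theorem form_ne_zero {H : Submodule K (Fin l → K)} (hH : H ∈ A.hyperplanes) : A.form H ≠ 0 := by
  intro h
  refine (A.isCoatom_of_mem H hH).1 (eq_top_iff.mpr fun v _ => ?_)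
  rw [A.mem_iff_eval_form H hH, h, map_zero]

variable {A} in
theorem irreducible_form {H : Submodule K (Fin l → K)} (hH : H ∈ A.hyperplanes) :
    Irreducible (A.form H) :=
  irreducible_of_isHomogeneous_one (A.form_isHomogeneous H hH) (form_ne_zero hH)

variable {A} in
theorem eq_of_form_dvd {H H' : Submodule K (Fin l → K)} (hH : H ∈ A.hyperplanes)
    (hH' : H' ∈ A.hyperplanes) (h : A.form H ∣ A.form H') : H = H' := by
  obtain ⟨u, hu⟩ := ((irreducible_form hH).dvd_irreducible_iff_associated
    (irreducible_form hH')).mp h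
  ext v
  rw [A.mem_iff_eval_form H hH, A.mem_iff_eval_form H' hH', ← hu, map_mul]
  exact (((u.isUnit.map (eval v)).mul_left_eq_zero).symm)

theorem definingPolynomial_ne_zero : A.definingPolynomial ≠ 0 :=
  Finset.prod_ne_zero_iff.mpr fun _ hH => form_ne_zero hH

theorem isHomogeneous_definingPolynomial :
    A.definingPolynomial.IsHomogeneous A.hyperplanes.card := by
  have := IsHomogeneous.prod A.hyperplanes A.form (fun _ => 1) A.form_isHomogeneous
  rwa [Finset.sum_const, smul_eq_mul, mul_one] at this

-- The coefficient matrix applied to the coefficient vector of `α_H` has entries `θ i (α_H)`, all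
-- divisible by `α_H`; hence so is the determinant. Forms of distinct hyperplanes are coprime, so
-- their product divides it too.
variable {A} in
theorem definingPolynomial_dvd_det
    {θ : Fin l → Derivation K (MvPolynomial (Fin l) K) (MvPolynomial (Fin l) K)}
    (hθ : ∀ i, θ i ∈ A.logDerivations) : A.definingPolynomial ∣ (coeffMatrix θ).det := by
  refine Finset.prod_dvd_of_isRelPrime (fun H hH H' hH' hne => ?_) fun H hH => ?_
  · exact (irreducible_form hH).isRelPrime_iff_not_dvd.mpr fun h => hne (eq_of_form_dvd hH hH' h)
  · obtain ⟨j, hj⟩ := exists_coeff_single_ne_zero (A.form_isHomogeneous H hH) (form_ne_zero hH)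
    refine Matrix.dvd_det_of_forall_dvd_mulVec _
      (v := fun j => C (coeff (Finsupp.single j 1) (A.form H))) (j := j)
      ((isUnit_iff_ne_zero.mpr hj).map C) fun i => ?_
    have := Ideal.mem_span_singleton.mp (hθ i H hH)
    rw [derivation_apply_of_isHomogeneous_one _ (A.form_isHomogeneous H hH)] at this
    simpa only [Matrix.mulVec, dotProduct, coeffMatrix_apply, mul_comm] using this

variable {A} in
/-- One direction of Saito's criterion. -/
theorem exists_basis_of_associated_det
    {θ : Fin l → Derivation K (MvPolynomial (Fin l) K) (MvPolynomial (Fin l) K)}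
    (hθ : ∀ i, θ i ∈ A.logDerivations)
    (hdet : Associated A.definingPolynomial (coeffMatrix θ).det) :
    ∃ b : Module.Basis (Fin l) (MvPolynomial (Fin l) K) A.logDerivations,
      ∀ i, (b i : Derivation K (MvPolynomial (Fin l) K) (MvPolynomial (Fin l) K)) = θ i := by
  obtain ⟨u, hu⟩ := hdet
  have hdet0 : (coeffMatrix θ).det ≠ 0 := by
    rw [← hu]
    exact mul_ne_zero A.definingPolynomial_ne_zero u.ne_zero
  have hli : LinearIndependent (MvPolynomial (Fin l) K)
      (fun i => (⟨θ i, hθ i⟩ : A.logDerivations)) := by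
    let Φ : A.logDerivations →ₗ[MvPolynomial (Fin l) K] (Fin l → MvPolynomial (Fin l) K) :=
      { toFun := fun δ j => δ.1 (X j)
        map_add' := fun _ _ => rfl
        map_smul' := fun _ _ => rfl }
    exact LinearIndependent.of_comp Φ (Matrix.linearIndependent_rows_of_det_ne_zero hdet0)
  refine ⟨Module.Basis.mk hli fun δ _ => ?_, fun i => by rw [Module.Basis.mk_apply]⟩
  -- Cramer's rule: each numerator is the determinant of a logarithmic family with one member
  -- replaced by `δ`, so it is divisible by `Q`, and the quotients are polynomial.
  have hdvd : ∀ i, A.definingPolynomial ∣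
      (coeffMatrix θ).transpose.cramer (fun j => δ.1 (X j)) i := by
    intro i
    rw [Matrix.cramer_transpose_apply]
    have : (coeffMatrix θ).updateRow i (fun j => δ.1 (X j)) =
        coeffMatrix (Function.update θ i δ.1) := by
      ext1 k j
      by_cases hk : k = i
      · subst hk; simp [coeffMatrix_apply]
      · simp [coeffMatrix_apply, hk]
    rw [this]
    refine definingPolynomial_dvd_det fun k => ?_
    by_cases hk : k = i
    · subst hk; simp
    · simpa [hk] using hθ k
  choose r hr using hdvd
  have hδ : δ = ∑ i, ((↑u⁻¹ : MvPolynomial (Fin l) K) * r i) •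
      (⟨θ i, hθ i⟩ : A.logDerivations) := by
    refine Subtype.ext (derivation_ext fun j => ?_)
    have h1 := congrFun (Matrix.mulVec_cramer (coeffMatrix θ).transpose
      (fun j => δ.1 (X j))) j
    rw [Matrix.det_transpose, ← hu] at h1
    simp only [Matrix.mulVec, dotProduct, hr, Matrix.transpose_apply, coeffMatrix_apply,
      Pi.smul_apply, smul_eq_mul, mul_left_comm _ A.definingPolynomial, ← Finset.mul_sum,
      mul_assoc A.definingPolynomial] at h1
    have h2 := mul_left_cancel₀ A.definingPolynomial_ne_zero h1
    have h3 : δ.1 (X j) = ↑u⁻¹ * ∑ i, θ i (X j) * r i := by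
      rw [h2, Units.inv_mul_cancel_left]
    rw [h3, Finset.mul_sum]
    simp only [Submodule.coe_sum, Submodule.coe_smul, derivation_sum_apply, Derivation.smul_apply,
      smul_eq_mul]
    exact Finset.sum_congr rfl fun i _ => by ring
  rw [hδ]
  exact Submodule.sum_mem _ fun i _ => Submodule.smul_mem _ _ (Submodule.subset_span ⟨i, rfl⟩)

variable {A} in
theorem det_basis_dvd_det
    (b : Module.Basis (Fin l) (MvPolynomial (Fin l) K) A.logDerivations)
    {θ : Fin l → Derivation K (MvPolynomial (Fin l) K) (MvPolynomial (Fin l) K)}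
    (hθ : ∀ i, θ i ∈ A.logDerivations) :
    (coeffMatrix fun i => (b i).1).det ∣ (coeffMatrix θ).det := by
  have : coeffMatrix θ =
      (Matrix.of fun i k => b.repr ⟨θ i, hθ i⟩ k) * coeffMatrix fun i => (b i).1 := by
    ext1 i j
    have h1 := congrArg (fun δ : A.logDerivations =>
      (δ : Derivation K (MvPolynomial (Fin l) K) (MvPolynomial (Fin l) K)) (X j))
      (b.sum_repr ⟨θ i, hθ i⟩)
    simpa [derivation_sum_apply, Matrix.mul_apply, coeffMatrix_apply, -Module.Basis.sum_repr]
      using h1.symm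
  rw [this, Matrix.det_mul]
  exact Dvd.intro_left _ rfl

/-- This gives a logarithmic family whose determinant contains `α_H` exactly once. With `α_H = ∑ a_j
x_j` and `a_{j₀} ≠ 0`, the fields are `R α_H ∂_{j₀}` and `R (a_{j₀} ∂_i - a_i ∂_{j₀})` for `i ≠ j₀`;
the latter kill `α_H`, and `R` handles the other hyperplanes. -/
theorem exists_det_eq_pow {H : Submodule K (Fin l → K)} (hH : H ∈ A.hyperplanes) :
    ∃ θ : Fin l → Derivation K (MvPolynomial (Fin l) K) (MvPolynomial (Fin l) K),
      (∀ i, θ i ∈ A.logDerivations) ∧ ∃ w : MvPolynomial (Fin l) K, IsUnit w ∧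
        (coeffMatrix θ).det =
          (∏ H' ∈ A.hyperplanes.erase H, A.form H') ^ l * (A.form H * w) := by
  set R := ∏ H' ∈ A.hyperplanes.erase H, A.form H'
  set a : Fin l → K := fun j => coeff (Finsupp.single j 1) (A.form H)
  obtain ⟨j₀, hj₀⟩ : ∃ j, a j ≠ 0 :=
    exists_coeff_single_ne_zero (A.form_isHomogeneous H hH) (form_ne_zero hH)
  let d : Fin l → MvPolynomial (Fin l) K := fun i => if i = j₀ then A.form H else C (a j₀)
  let u : Fin l → MvPolynomial (Fin l) K := fun i => if i = j₀ then 0 else C (-(a i / a j₀))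
  let v : Fin l → MvPolynomial (Fin l) K := Pi.single j₀ 1
  let T : Matrix (Fin l) (Fin l) (MvPolynomial (Fin l) K) := Matrix.of fun i j =>
    R * (d i * ((if i = j then 1 else 0) + if j = j₀ then u i else 0))
  have hT : ∀ i j, T i j = R * (d i * ((if i = j then 1 else 0) + if j = j₀ then u i else 0)) :=
    fun i j => rfl
  have hT' : T = R •
      (Matrix.diagonal d * (1 + Matrix.replicateCol Unit u * Matrix.replicateRow Unit v)) := by
    ext1 i j
    rw [hT, Matrix.smul_apply, Matrix.diagonal_mul, smul_eq_mul]
    simp [Matrix.one_apply, Matrix.mul_apply, v, Pi.single_apply]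
  let θ : Fin l → Derivation K (MvPolynomial (Fin l) K) (MvPolynomial (Fin l) K) :=
    fun i => mkDerivation K (T i)
  have hθT : coeffMatrix θ = T := by
    ext1 i j
    simp [coeffMatrix_apply, θ]
  have hθf : ∀ i H', H' ∈ A.hyperplanes → θ i (A.form H') =
      R * (d i * (C (coeff (Finsupp.single i 1) (A.form H')) +
        C (coeff (Finsupp.single j₀ 1) (A.form H')) * u i)) := by
    intro i H' hH'
    rw [derivation_apply_of_isHomogeneous_one _ (A.form_isHomogeneous H' hH')]
    simp only [θ, mkDerivation_X, hT, mul_add, Finset.sum_add_distrib, mul_ite, mul_one, mul_zero,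
      Finset.sum_ite_eq, Finset.sum_ite_eq', Finset.mem_univ, if_true]
    ring
  refine ⟨θ, fun i H' hH' => ?_, ∏ i ∈ Finset.univ.erase j₀, C (a j₀), ?_, ?_⟩
  · rw [hθf i H' hH', Ideal.mem_span_singleton]
    by_cases hHH : H' = H
    · subst hHH
      by_cases hi : i = j₀
      · simp only [d, hi, if_true]
        exact (Dvd.intro _ rfl).mul_left _
      · have : C (coeff (Finsupp.single i 1) (A.form H')) +
            C (coeff (Finsupp.single j₀ 1) (A.form H')) * u i = 0 := by
          simp only [u, hi, if_false, ← C_mul, ← C_add]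
          change C (a i + a j₀ * (-(a i / a j₀))) = 0
          rw [mul_neg, mul_div_cancel₀ _ hj₀, add_neg_cancel, C_0]
        rw [this, mul_zero, mul_zero]
        exact dvd_zero _
    · exact (Finset.dvd_prod_of_mem _ (Finset.mem_erase.mpr ⟨hHH, hH'⟩)).mul_right _
  · exact (Finset.prod_const (C (a j₀) : MvPolynomial (Fin l) K)).symm ▸
      ((isUnit_iff_ne_zero.mpr hj₀).map C).pow _
  · rw [hθT, hT', Matrix.det_smul, Matrix.det_mul, Matrix.det_diagonal,
      Matrix.det_one_add_replicateCol_mul_replicateRow, Fintype.card_fin,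
      ← Finset.mul_prod_erase Finset.univ d (Finset.mem_univ j₀)]
    have h1 : v ⬝ᵥ u = 0 := by simp [v, u]
    have h2 : ∏ i ∈ Finset.univ.erase j₀, d i =
        ∏ i ∈ Finset.univ.erase j₀, (C (a j₀) : MvPolynomial (Fin l) K) :=
      Finset.prod_congr rfl fun i hi => if_neg (Finset.ne_of_mem_erase hi)
    rw [h1, h2, add_zero, mul_one]
    simp [d]

variable {A} in
/-- The other direction of Saito's criterion. -/
theorem associated_det_basis
    (b : Module.Basis (Fin l) (MvPolynomial (Fin l) K) A.logDerivations) :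
    Associated A.definingPolynomial (coeffMatrix fun i => (b i).1).det := by
  obtain ⟨f, hf⟩ := definingPolynomial_dvd_det fun i => (b i).2
  have hQ := A.definingPolynomial_ne_zero
  have hpow : (coeffMatrix fun i => (b i).1).det ∣ A.definingPolynomial ^ l := by
    have h1 := det_basis_dvd_det b
      (θ := fun i => A.definingPolynomial • pderiv i) fun i H hH =>
        Ideal.mul_mem_right _ _ (Ideal.mem_span_singleton.mpr (Finset.dvd_prod_of_mem _ hH))
    have h2 : coeffMatrix (fun i : Fin l => A.definingPolynomial • pderiv (R := K) i) =
        A.definingPolynomial • 1 := by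
      ext1 i j
      simp [coeffMatrix_apply, pderiv_X, Matrix.one_apply, Pi.single_apply, eq_comm]
    rwa [h2, Matrix.det_smul, Matrix.det_one, mul_one, Fintype.card_fin] at h1
  have hf0 : f ≠ 0 := by
    rintro rfl
    rw [hf, mul_zero, zero_dvd_iff] at hpow
    exact pow_ne_zero l hQ hpow
  -- The determinant divides a power of `Q`, so an irreducible factor of `f` would be some `α_H` up
  -- to a unit. Then `α_H ^ 2` would divide the determinant of every logarithmic family,
  -- contradicting `exists_det_eq_pow`.
  have hfu : IsUnit f := by
    by_contra hfu
    obtain ⟨q, hq, hqf⟩ := WfDvdMonoid.exists_irreducible_factor hfu hf0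
    have hq1 : q ∣ A.definingPolynomial :=
      hq.prime.dvd_of_dvd_pow ((hqf.trans (hf ▸ Dvd.intro_left _ rfl)).trans hpow)
    obtain ⟨H, hH, hqH⟩ := hq.prime.exists_mem_finset_dvd hq1
    have hHf : A.form H ∣ f :=
      ((hq.dvd_irreducible_iff_associated (irreducible_form hH)).mp hqH).symm.dvd.trans hqf
    obtain ⟨θ, hθ, w, hw, hdet⟩ := A.exists_det_eq_pow hH
    have h1 := det_basis_dvd_det b hθ
    rw [hf, hdet, definingPolynomial, ← Finset.mul_prod_erase _ _ hH, mul_assoc,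
      mul_left_comm _ (A.form H), mul_dvd_mul_iff_left (form_ne_zero hH)] at h1
    have h2 := (hHf.mul_left _).trans h1
    have hp := (irreducible_form hH).prime
    rcases hp.dvd_or_dvd h2 with h3 | h3
    · obtain ⟨H', hH', h4⟩ := hp.exists_mem_finset_dvd (hp.dvd_of_dvd_pow h3)
      exact Finset.ne_of_mem_erase hH' (eq_of_form_dvd hH (Finset.mem_of_mem_erase hH') h4).symm
    · exact hp.not_isUnit (isUnit_of_dvd_unit h3 hw)
  exact ⟨hfu.unit, hf.symm⟩

variable {A} in
theorem derivationComponent_mem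
    {δ : Derivation K (MvPolynomial (Fin l) K) (MvPolynomial (Fin l) K)}
    (hδ : δ ∈ A.logDerivations) (n : ℕ) : derivationComponent n δ ∈ A.logDerivations := by
  intro H hH
  rw [derivationComponent_apply n δ (A.form_isHomogeneous H hH), Ideal.mem_span_singleton]
  exact dvd_homogeneousComponent (A.form_isHomogeneous H hH)
    (Ideal.mem_span_singleton.mp (hδ H hH)) n

variable {A} in
/-- An arrangement is free as soon as some family of logarithmic vector fields has a coefficient
determinant which is the product of the defining polynomial and a polynomial not vanishing at the
origin. -/
theorem isFree_of_det_eq_mul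
    {θ : Fin l → Derivation K (MvPolynomial (Fin l) K) (MvPolynomial (Fin l) K)}
    (hθ : ∀ i, θ i ∈ A.logDerivations) {h : MvPolynomial (Fin l) K} (h0 : coeff 0 h ≠ 0)
    (hdet : (coeffMatrix θ).det = A.definingPolynomial * h) : A.IsFree := by
  have hQ := A.definingPolynomial_ne_zero
  -- In degree `deg Q` the determinant has component `Q` times the constant term of `h`, which is
  -- nonzero.
  obtain ⟨e, he, hne⟩ := exists_det_homogeneousComponent_ne_zero (coeffMatrix θ)
    (A.hyperplanes.card + 0) (by
      rw [hdet, homogeneousComponent_mul_of_isHomogeneous A.isHomogeneous_definingPolynomial,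
        homogeneousComponent_zero]
      exact mul_ne_zero hQ (C_ne_zero.mpr h0))
  let η := fun i => derivationComponent (e i) (θ i)
  have hη : ∀ i, η i ∈ A.logDerivations := fun i => derivationComponent_mem (hθ i) _
  have hM : coeffMatrix η =
      Matrix.of fun i j => homogeneousComponent (e i) (coeffMatrix θ i j) := by
    ext1 i j
    exact derivationComponent_X _ _ _
  rw [← hM] at hne
  have hhom : (coeffMatrix η).det.IsHomogeneous (A.hyperplanes.card + 0) := he ▸
    isHomogeneous_det _ e fun i j => by
      rw [hM]
      exact homogeneousComponent_isHomogeneous _ _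
  obtain ⟨r, hr⟩ := definingPolynomial_dvd_det hη
  -- The new determinant is a multiple of `Q` and homogeneous of the same degree, so the cofactor
  -- reduces to its constant term.
  have hr' : (coeffMatrix η).det = A.definingPolynomial * C (coeff 0 r) := by
    rw [← homogeneousComponent_zero,
      ← homogeneousComponent_mul_of_isHomogeneous A.isHomogeneous_definingPolynomial, ← hr,
      homogeneousComponent_eq_self hhom]
  have hr0 : coeff 0 r ≠ 0 := fun h => hne (by rw [hr', h, C_0, mul_zero])
  obtain ⟨b, hb⟩ := exists_basis_of_associated_det hη
    ⟨((isUnit_iff_ne_zero.mpr hr0).map C).unit, hr'.symm⟩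
  refine ⟨e, b, fun i j => ?_⟩
  rw [hb]
  exact (derivationComponent_X (e i) (θ i) j).symm ▸ homogeneousComponent_isHomogeneous _ _

/-! ### Freeness of localizations and conclusion -/

variable {A} in
theorem IsFree.localization [Infinite K] (hA : A.IsFree) (X : Submodule K (Fin l → K)) :
    (A.localization X).IsFree := by
  obtain ⟨-, b, -⟩ := hA
  obtain ⟨p, hp, hgp⟩ := A.exists_mem_eval_residualPolynomial_ne_zero X
  obtain ⟨u, hu⟩ := associated_det_basis b
  have hσ := A.localization_isPreservedBy_affineAut X hp 1
  obtain ⟨v, hv⟩ := hσ.associated_definingPolynomial.symm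
  -- The constant `c` collects both unit ambiguities: `u` from Saito's criterion and `v` from the
  -- translation of `Q(A_X)`, pulled back so that the translation sends the product to `σ(u) v`.
  obtain ⟨c, hc, huc⟩ := isUnit_iff_eq_C_of_isReduced.mp (u * Units.map
    ((affineAut p 1).symm : MvPolynomial (Fin l) K →* MvPolynomial (Fin l) K) v).isUnit
  refine isFree_of_det_eq_mul
    (θ := fun i => conjDerivation (affineAut p 1) (b i).1)
    (h := affineAut p 1 (A.residualPolynomial X) * C c)
    (fun i => hσ.conjDerivation_mem (A.logDerivations_le_localization X (b i).2)) ?_ ?_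
  · rw [← constantCoeff_eq, map_mul, constantCoeff_C, ← eval_zero, eval_affineAut]
    exact mul_ne_zero (by simpa using hgp) hc.ne_zero
  · have hM : coeffMatrix (fun i => conjDerivation (affineAut p 1) (b i).1) =
        (affineAut p 1 : MvPolynomial (Fin l) K →+* MvPolynomial (Fin l) K).mapMatrix
          (coeffMatrix fun i => (b i).1) := by
      ext1 i j
      have hX : (affineAut p 1).symm (MvPolynomial.X j) = MvPolynomial.X j - C (p j) := by
        rw [AlgEquiv.symm_apply_eq, map_sub, affineAut_X, affineAut_C]
        simp
      simp [coeffMatrix_apply, conjDerivation_apply, hX]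
    have hcv : affineAut p 1 (u : MvPolynomial (Fin l) K) * (v : MvPolynomial (Fin l) K) = C c := by
      rw [← affineAut_C p 1 c, ← huc]
      simp
    rw [hM, ← RingHom.map_det, ← hu, ← A.localization_definingPolynomial_mul X, ← hcv]
    change affineAut p 1 _ = _
    rw [map_mul, map_mul, ← hv]
    ring

end CentralArrangement

theorem corollary5p2 {K : Type*} [Field K] [CharZero K] {l : ℕ} (A : CentralArrangement K l)
    (X : Submodule K (Fin l → K)) (hX : X ∈ A.flats) :
    CategoryTheory.projectiveDimension
        (ModuleCat.of (MvPolynomial (Fin l) K)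
          (MvPolynomial (Fin l) K ⧸ (A.localization X).jacobianIdeal)) ≤
      CategoryTheory.projectiveDimension
        (ModuleCat.of (MvPolynomial (Fin l) K)
          (MvPolynomial (Fin l) K ⧸ A.jacobianIdeal)) ∧
    CategoryTheory.projectiveDimension
        (ModuleCat.of (MvPolynomial (Fin l) K) (A.localization X).logDerivations) ≤
      CategoryTheory.projectiveDimension
        (ModuleCat.of (MvPolynomial (Fin l) K) A.logDerivations) ∧
    (A.IsFree → (A.localization X).IsFree) := by
  have : Infinite K := CharZero.infinite K
  exact ⟨CategoryTheory.projectiveDimension_le_of_forall_hasProjectiveDimensionLT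
      (A.hasProjectiveDimensionLT_quotient_localization X),
    CategoryTheory.projectiveDimension_le_of_forall_hasProjectiveDimensionLT
      (A.hasProjectiveDimensionLT_logDerivations_localization X),
    fun hA => hA.localization X⟩
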